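/- Let $G=(V,E)$ be a finite simple undirected graph with at least one edge and maximum degree $d$, and let $\beta_{i,j}=\beta_{j,i}\ge 0$ for $\{i,j\}\in E$. Put $\underline\beta=\min_{\{i,j\}\in E}\beta_{i,j}$ and $\overline\beta=\max_{\{i,j\}\in E}\beta_{i,j}$. Each $i\in V$ is an agent with a private signal $S_i\in\{-1,1\}$, and the signals are jointly distributed according to the zero-field ferromagnetic Ising model $$\Pr[\mathbf S=\mathbf s]\propto\exp\Big(\sum_{\{i,j\}\in E}\beta_{i,j}s_is_j\Big),\qquad \mathbf s\in\{-1,1\}^V .$$ A strategy of an agent is a map $\sigma$ giving the probability $\sigma(s,\hat s)$ of reporting $\hat s\in\{-1,1\}$ on signal $s$; given the signals, the agents randomize independently. A mechanism pays agent $i$ an amount $M_i(\hat{\mathbf s})$ depending on all reports. A strategy profile is a Bayesian Nash equilibrium (BNE) if no agent can increase her expected payment by unilaterally changing her strategy, and a strict BNE if every such change strictly decreases it. A profile is symmetric if all agents use the same strategy, and a permutation profile if all agents report $\pi(s_i)$ for one and the same permutation $\pi$ of $\{-1,1\}$ (truth-telling is the case $\pi=\mathrm{id}$). A mechanism is symmetrically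 strongly truthful if truth-telling is a strict BNE, permutation profiles are BNEs, and in every symmetric BNE each agent's expected payment is at most her expected payment under truth-telling, with equality exactly when the profile is a permutation profile. Assume $$\frac{2\underline\beta}{d}>\ln\frac{e^{2(d+1)\overline\beta}+1}{e^{2\overline\beta}+e^{2d\overline\beta}} .$$ Then: (1) For all agents $i,j,k$ with $\{i,j\}\in E$, $k\ne i$ and $\{i,k\}\notin E$, the signal of $j$ uniformly dominates the signal of $k$ for the signal of $i$, that is, $\Pr[S_j=1\mid S_i=1]>\Pr[S_k=1\mid S_i=1]$ and $\Pr[S_j=-1\mid S_i=-1]>\Pr[S_k=-1\mid S_i=-1]$. (2) For every choice, for each agent $i$, of a friend $j(i)$ with $\{i,j(i)\}\in E$ and a non-friend $k(i)\ne i$ with $\{i,k(i)\}\notin E$, the bonus-penalty payment mechanism $M_i(\hat{\mathbf s})=\hat s_i\hat s_{j(i)}-\hat s_i\hat s_{k(i)}$ is symmetrically strongly truthful. -/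

import Mathlib

open scoped BigOperators

noncomputable section

namespace PeerPrediction

/-- The set `{-1, 1}` of binary signals and reports, realized as the units of `ℤ`. -/
abbrev Signal : Type := ℤˣ

/-- The numerical value `±1` of a signal. -/
def Signal.val (s : Signal) : ℝ := ((s : ℤ) : ℝ)

/-! ### Signal distributions

A joint distribution of the agents' signals is given by its mass function
`P : (V → Signal) → ℝ`. -/

/-- The probability of an event under the mass function `P`. -/
def prob {V : Type*} [Fintype V] [DecidableEq V] (P : (V → Signal) → ℝ)
    (A : (V → Signal) → Prop) [DecidablePred A] : ℝ :=
  ∑ s with A s, P s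

/-- The conditional probability of the event `A` given the event `B`. -/
def condProb {V : Type*} [Fintype V] [DecidableEq V] (P : (V → Signal) → ℝ)
    (A B : (V → Signal) → Prop) [DecidablePred A] [DecidablePred B] : ℝ :=
  prob P (fun s => A s ∧ B s) / prob P B

/-- Agent `j`'s signal uniformly dominates agent `k`'s signal for agent `i`'s signal. -/
def UniformlyDominates {V : Type*} [Fintype V] [DecidableEq V] (P : (V → Signal) → ℝ)
    (i j k : V) : Prop :=
  condProb P (fun s => s k = 1) (fun s => s i = 1) <
      condProb P (fun s => s j = 1) (fun s => s i = 1) ∧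
    condProb P (fun s => s k = -1) (fun s => s i = -1) <
      condProb P (fun s => s j = -1) (fun s => s i = -1)

/-! ### The zero-field Ising model -/

/-- The product `s_i s_j` over the two endpoints of the unordered pair `{i, j}`. -/
def edgeProd {V : Type*} (s : V → Signal) : Sym2 V → ℝ :=
  Sym2.lift ⟨fun i j => (s i).val * (s j).val, fun _ _ => mul_comm _ _⟩

/-- The energy `H(s) = ∑_{ {i,j} ∈ E } β_{i,j} s_i s_j`, every edge counted once. -/
def isingEnergy {V : Type*} [Fintype V] [DecidableEq V] (G : SimpleGraph V)
    [DecidableRel G.Adj] (β : Sym2 V → ℝ) (s : V → Signal) : ℝ :=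
  ∑ e ∈ G.edgeFinset, β e * edgeProd s e

/-- The mass function of the Ising model, `Pr[S = s] ∝ exp (H(s))`. -/
def isingMass {V : Type*} [Fintype V] [DecidableEq V] (G : SimpleGraph V)
    [DecidableRel G.Adj] (β : Sym2 V → ℝ) (s : V → Signal) : ℝ :=
  Real.exp (isingEnergy G β s) / ∑ t : V → Signal, Real.exp (isingEnergy G β t)

/-! ### Strategies, expected payments and equilibria -/

/-- A (randomized) strategy: `σ s r` is the probability of reporting `r` on signal `s`. -/
@[ext]
structure Strategy where
  toFun : Signal → Signal → ℝ
  nonneg : ∀ s r, 0 ≤ toFun s r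
  sum_eq_one : ∀ s, ∑ r, toFun s r = 1

/-- The deterministic strategy that relabels signals by the permutation `π`. -/
def Strategy.perm (π : Equiv.Perm Signal) : Strategy where
  toFun s r := if r = π s then 1 else 0
  nonneg s r := by split_ifs <;> norm_num
  sum_eq_one s := by rw [Finset.sum_ite_eq' Finset.univ, if_pos (Finset.mem_univ _)]

/-- The truthful strategy: report the observed signal. -/
def Strategy.truthful : Strategy where
  toFun s r := if r = s then 1 else 0
  nonneg s r := by split_ifs <;> norm_num
  sum_eq_one s := by rw [Finset.sum_ite_eq' Finset.univ, if_pos (Finset.mem_univ _)]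

/-- The truth-telling strategy profile. -/
def truthTelling {V : Type*} : V → Strategy := fun _ => Strategy.truthful

/-- A profile is symmetric if all agents use the same strategy. -/
def IsSymmetric {V : Type*} (σ : V → Strategy) : Prop := ∀ i j, σ i = σ j

/-- In a permutation profile all agents relabel their signals by one and the same permutation. -/
def IsPermutationProfile {V : Type*} (σ : V → Strategy) : Prop :=
  ∃ π : Equiv.Perm Signal, ∀ i, σ i = Strategy.perm π

/-- A mechanism pays agent `i` the amount `M i r` when the reports are `r`. -/
abbrev Mechanism (V : Type*) : Type _ := V → (V → Signal) → ℝ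

/-- Agent `i`'s ex-ante expected payment: signals are drawn from `P` and, given the signals,
the agents' reports are independent, agent `v` reporting according to `σ v`. -/
def expectedPayment {V : Type*} [Fintype V] [DecidableEq V] (P : (V → Signal) → ℝ)
    (M : Mechanism V) (σ : V → Strategy) (i : V) : ℝ :=
  ∑ s : V → Signal, P s * ∑ r : V → Signal, (∏ v, (σ v).toFun (s v) (r v)) * M i r

/-- Bayesian Nash equilibrium: no agent gains by a unilateral change of strategy. -/
def IsBNE {V : Type*} [Fintype V] [DecidableEq V] (P : (V → Signal) → ℝ)
    (M : Mechanism V) (σ : V → Strategy) : Prop :=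
  ∀ (i : V) (τ : Strategy),
    expectedPayment P M (Function.update σ i τ) i ≤ expectedPayment P M σ i

/-- Strict Bayesian Nash equilibrium: every unilateral change of strategy strictly decreases
the payment of the agent who makes it. -/
def IsStrictBNE {V : Type*} [Fintype V] [DecidableEq V] (P : (V → Signal) → ℝ)
    (M : Mechanism V) (σ : V → Strategy) : Prop :=
  ∀ (i : V) (τ : Strategy), τ ≠ σ i →
    expectedPayment P M (Function.update σ i τ) i < expectedPayment P M σ i

/-- Truth-telling is a strict equilibrium; permutation profiles are equilibria; and in every
symmetric equilibrium each agent is paid at most her truth-telling payment, with equality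
exactly for the permutation profiles. -/
structure SymmetricallyStronglyTruthful {V : Type*} [Fintype V] [DecidableEq V]
    (P : (V → Signal) → ℝ) (M : Mechanism V) : Prop where
  strictBNE : IsStrictBNE P M truthTelling
  permutation_isBNE : ∀ σ : V → Strategy, IsPermutationProfile σ → IsBNE P M σ
  payment_le : ∀ σ : V → Strategy, IsSymmetric σ → IsBNE P M σ → ∀ i,
    expectedPayment P M σ i ≤ expectedPayment P M truthTelling i
  payment_eq_iff : ∀ σ : V → Strategy, IsSymmetric σ → IsBNE P M σ → ∀ i,
    (expectedPayment P M σ i = expectedPayment P M truthTelling i ↔ IsPermutationProfile σ)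

/-! ### The bonus-penalty payment mechanism on a network -/

/-- The bonus-penalty payment function. -/
def bonusPenalty (a b c : Signal) : ℝ := a.val * b.val - a.val * c.val

/-- A choice of a friend (neighbour) and of a non-friend (another agent who is not a neighbour)
for every agent. -/
structure PeerChoice {V : Type*} (G : SimpleGraph V) where
  friend : V → V
  nonfriend : V → V
  adj_friend : ∀ i, G.Adj i (friend i)
  nonfriend_ne : ∀ i, nonfriend i ≠ i
  not_adj_nonfriend : ∀ i, ¬ G.Adj i (nonfriend i)

/-- The network mechanism: agent `i` is paid the bonus-penalty payment on her own report, the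
report of her chosen friend and the report of her chosen non-friend. -/
def networkMechanism {V : Type*} {G : SimpleGraph V} (c : PeerChoice G) : Mechanism V :=
  fun i r => bonusPenalty (r i) (r (c.friend i)) (r (c.nonfriend i))

end PeerPrediction

end

/-! ### Hyperbolic tangent estimates and the numerical threshold. -/

namespace PeerPrediction

open Real

/-! Everything reduces to comparing the correlations `E[S_i S_j]`. In zero field every spin has mean
zero, so `Pr[S_j = a | S_i = a] = (1 + E[S_i S_j]) / 2`, and part (1) says that friends are strictly
more correlated than non-friends. For part (2), write the conditional mean report of a strategy as
`bias + gain * s`. If everyone else plays `ρ`, the bias terms of friend and non-friend cancel, and a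
strategy `τ` earns `τ.gain * ρ.gain` times the positive correlation gap; moreover `|gain| ≤ 1`, with
equality exactly for the permutations.

Let `b`, `B` be the extreme couplings, `t = tanh B` and `T = tanh (d * B)`. A friend has correlation
at least `tanh b` (`tanh_le_spinCorr`, from FKG). For a non-friend, a Simon-type inequality
(`spinCorr_le_sum_neighbor`), applied twice, gives at most `d * t * (t * (1 + (d - 1) * T))`. The
temperature condition is equivalent to `t * T < tanh (b / d)`, and `threshold_lt_tanh` shows that
this separates the two bounds. -/

theorem tanh_eq_exp (z : ℝ) : tanh z = (exp (2 * z) - 1) / (exp (2 * z) + 1) := by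
  have h1 : exp (2 * z) = exp z * exp z := by rw [← exp_add]; ring_nf
  have h2 : exp (-z) = (exp z)⁻¹ := exp_neg z
  have h3 := exp_pos z
  rw [tanh_eq_sinh_div_cosh, sinh_eq, cosh_eq, h1, h2]
  field_simp

theorem tanh_strictMono : StrictMono tanh := by
  intro x y hxy
  have h : exp (2 * x) < exp (2 * y) := exp_lt_exp.2 (by linarith)
  have h1 := exp_pos (2 * x)
  rw [tanh_eq_exp, tanh_eq_exp, div_lt_div_iff₀ (by linarith) (by linarith)]
  nlinarith

theorem tanh_nonneg {z : ℝ} (hz : 0 ≤ z) : 0 ≤ tanh z := by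
  simpa using tanh_strictMono.monotone hz

/-- A rational lower bound for the hyperbolic tangent. -/
theorem le_tanh {z : ℝ} (hz : 0 ≤ z) : z * (1 + z) / (1 + z + z ^ 2) ≤ tanh z := by
  -- `tanh z` is increasing in `exp (2 * z)`, which is at least `1 + 2z + 2z²`.
  have h := quadratic_le_exp_of_nonneg (x := 2 * z) (by linarith)
  rw [tanh_eq_exp, div_le_div_iff₀ (by positivity) (by positivity)]
  nlinarith

/-- The constant `12/13` is the value of `(1 + z) / (1 + z + z²)` at `z = 1/3`. -/
theorem mul_le_tanh {z : ℝ} (hz : 0 ≤ z) (hz' : z ≤ 1 / 3) : 12 / 13 * z ≤ tanh z := by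
  refine le_trans ?_ (le_tanh hz)
  rw [le_div_iff₀ (by positivity)]
  have h : 0 ≤ 1 + z - 12 * z ^ 2 := by nlinarith
  linarith [mul_nonneg hz h]

theorem tanh_le_self {z : ℝ} (hz : 0 ≤ z) : tanh z ≤ z := by
  have hd : ∀ x, HasDerivAt (fun x => x * cosh x - sinh x) (x * sinh x) x := fun x => by
    have := ((hasDerivAt_id x).mul (hasDerivAt_cosh x)).sub (hasDerivAt_sinh x)
    refine this.congr_deriv ?_
    simp
  have hm : MonotoneOn (fun x => x * cosh x - sinh x) (Set.Ici 0) := by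
    refine monotoneOn_of_deriv_nonneg (convex_Ici 0)
      (fun x _ => (hd x).continuousAt.continuousWithinAt)
      (fun x _ => (hd x).differentiableAt.differentiableWithinAt) fun x hx => ?_
    rw [interior_Ici] at hx
    rw [(hd x).deriv]
    exact mul_nonneg (le_of_lt hx) (sinh_nonneg_iff.2 (le_of_lt hx))
  have h := hm (Set.mem_Ici.2 le_rfl) (Set.mem_Ici.2 hz) hz
  simp only [sinh_zero, zero_mul, sub_zero, sub_nonneg] at h
  rw [tanh_eq_sinh_div_cosh, div_le_iff₀ (cosh_pos z)]
  exact h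

/-- Over a window of width `2b`, `tanh` grows most when the window is centred at `0`: with `x = exp
(2c)`, the deficit is a nonnegative multiple of `(x - 1)²`. -/
theorem tanh_add_sub_tanh_sub_le (c : ℝ) {b : ℝ} (hb : 0 ≤ b) :
    tanh (c + b) - tanh (c - b) ≤ 2 * tanh b := by
  have e1 : exp (2 * (c + b)) = exp (2 * c) * exp (2 * b) := by rw [← exp_add]; ring_nf
  have e2 : exp (2 * (c - b)) = exp (2 * c) / exp (2 * b) := by rw [← exp_sub]; ring_nf
  rw [tanh_eq_exp, tanh_eq_exp, tanh_eq_exp, e1, e2]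
  have hx := exp_pos (2 * c)
  have hy : 1 ≤ exp (2 * b) := one_le_exp (by linarith)
  generalize exp (2 * c) = x at *
  generalize exp (2 * b) = y at *
  have hy0 : 0 < y := by linarith
  have key : 2 * ((y - 1) / (y + 1)) -
      ((x * y - 1) / (x * y + 1) - (x / y - 1) / (x / y + 1)) =
      2 * (y - 1) * y * (x - 1) ^ 2 / ((y + 1) * (x * y + 1) * (x + y)) := by
    field_simp
    ring
  have : 0 ≤ 2 * (y - 1) * y * (x - 1) ^ 2 / ((y + 1) * (x * y + 1) * (x + y)) :=
    div_nonneg (mul_nonneg (mul_nonneg (by linarith) hy0.le) (sq_nonneg _)) (by positivity)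
  linarith

/-- The temperature condition, rewritten through hyperbolic tangents. -/
theorem tanh_mul_tanh_lt_of_log_lt {a b c : ℝ}
    (h : log ((exp (2 * a + 2 * b) + 1) / (exp (2 * a) + exp (2 * b))) < 2 * c) :
    tanh a * tanh b < tanh c := by
  rw [log_lt_iff_lt_exp (by positivity), div_lt_iff₀ (by positivity), exp_add] at h
  have hx := exp_pos (2 * a)
  have hy := exp_pos (2 * b)
  have hz := exp_pos (2 * c)
  rw [tanh_eq_exp a, tanh_eq_exp b, tanh_eq_exp c, div_mul_div_comm,
    div_lt_div_iff₀ (by positivity) (by positivity)]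
  nlinarith

/-- With `X = exp B` the hypothesis becomes `X³ < X + 1`, which forces `X < 4/3`; then `1 + B + B²/2
≤ X`. For `d ≥ 2` this makes `B` small. -/
theorem add_sq_div_two_lt_of_tanh_mul_tanh_lt {B : ℝ} (hB : 0 < B)
    (h : tanh B * tanh (2 * B) < tanh (B / 2)) : B + B ^ 2 / 2 < 1 / 3 := by
  have hq := quadratic_le_exp_of_nonneg hB.le
  have e0 : exp (2 * (B / 2)) = exp B := by ring_nf
  have e1 : exp (2 * B) = exp B ^ 2 := by rw [← exp_nat_mul]; norm_num
  have e2 : exp (2 * (2 * B)) = exp B ^ 4 := by rw [← exp_nat_mul]; ring_nf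
  rw [tanh_eq_exp, tanh_eq_exp, tanh_eq_exp (B / 2), e0, e1, e2] at h
  have hX : 1 < exp B := one_lt_exp_iff.2 hB
  generalize exp B = X at *
  rw [div_mul_div_comm, div_lt_div_iff₀ (by positivity) (by positivity)] at h
  have key : (X - 1) * (X ^ 2 + 1) * (2 * (1 + X - X ^ 3)) =
      (X - 1) * ((X ^ 2 + 1) * (X ^ 4 + 1)) - (X ^ 2 - 1) * (X ^ 4 - 1) * (X + 1) := by ring
  have hp : 0 < (X - 1) * (X ^ 2 + 1) := mul_pos (by linarith) (by positivity)
  have : 0 < 2 * (1 + X - X ^ 3) := by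
    refine pos_of_mul_pos_right (a := (X - 1) * (X ^ 2 + 1)) ?_ hp.le
    linarith
  have hX3 : X < 4 / 3 := by
    by_contra hcon
    push Not at hcon
    nlinarith [mul_nonneg (by linarith : (0:ℝ) ≤ X - 4 / 3) (by positivity : 0 ≤ X ^ 2)]
  linarith

/-- For `d = 1` this is the hypothesis itself. For `d ≥ 2`, `z = d * t * T` satisfies `z < b ≤ B <
1/3`, so `12/13 * z ≤ tanh z < tanh b`. It remains to prove `t * (1 + (d - 1) * T) ≤ 12/13 * T`. -/
theorem threshold_lt_tanh {d : ℕ} (hd : 1 ≤ d) {b B : ℝ} (hbB : b ≤ B) (hB : 0 ≤ B)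
    (h : tanh B * tanh (d * B) < tanh (b / d)) :
    d * tanh B * (tanh B * (1 + (d - 1) * tanh (d * B))) < tanh b := by
  have hd0 : (0 : ℝ) < d := by exact_mod_cast hd
  have ht0 := tanh_nonneg hB
  have hT0 : 0 ≤ tanh (d * B) := tanh_nonneg (by positivity)
  have hb : 0 < b := by
    have : tanh 0 < tanh (b / d) := by rw [tanh_zero]; nlinarith [mul_nonneg ht0 hT0]
    have := tanh_strictMono.lt_iff_lt.1 this
    exact (div_pos_iff_of_pos_right hd0).1 this
  have hBpos : 0 < B := by linarith
  obtain rfl | hd2 := hd.eq_or_lt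
  · simpa using h
  have hd2' : (2 : ℝ) ≤ d := by exact_mod_cast hd2
  have hBq : B + B ^ 2 / 2 < 1 / 3 := by
    refine add_sq_div_two_lt_of_tanh_mul_tanh_lt hBpos ?_
    calc tanh B * tanh (2 * B) ≤ tanh B * tanh (d * B) :=
          mul_le_mul_of_nonneg_left (tanh_strictMono.monotone (by nlinarith)) ht0
      _ < tanh (b / d) := h
      _ ≤ tanh (B / 2) := tanh_strictMono.monotone (by gcongr)
  have hB3 : B < 291 / 1000 := by nlinarith
  set t := tanh B with ht
  set T := tanh (d * B) with hT
  set y := d * B with hy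
  have hypos : 0 < y := by positivity
  have hz : d * (t * T) < b := by
    have := h.trans_le (tanh_le_self (z := b / d) (by positivity))
    rwa [lt_div_iff₀ hd0, mul_comm] at this
  have htq := le_tanh hB
  have htB := tanh_le_self hB
  have hTq := le_tanh hypos.le
  rw [← ht] at htq htB
  rw [← hT] at hTq
  rw [div_le_iff₀ (by positivity)] at htq hTq
  have htpos : 0 < t := by rw [ht, ← tanh_zero]; exact tanh_strictMono hBpos
  have hTpos : 0 < T := by rw [hT, ← tanh_zero]; exact tanh_strictMono hypos
  -- From `d * T * t < b ≤ B` and the rational lower bound for `t`, `d * T < 1 + B² / (1 + B)`, and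
  -- `B` is small.
  have hdT : d * T < 13 / 12 := by
    have h1 : d * T * t < B := by linarith
    have h2 : d * T * (B * (1 + B)) < B * (1 + B + B ^ 2) := by
      calc d * T * (B * (1 + B)) ≤ d * T * (t * (1 + B + B ^ 2)) := by gcongr
        _ = d * T * t * (1 + B + B ^ 2) := by ring
        _ < B * (1 + B + B ^ 2) := by gcongr
    have h3 : d * T * (1 + B) < 1 + B + B ^ 2 := by
      refine lt_of_mul_lt_mul_left (a := B) ?_ hB
      linarith
    by_contra hcon
    push Not at hcon
    nlinarith
  -- The polynomial is `(1 + y)(12d - 13(d - 1)y) - 13(1 + y + y²)`, whose sign decides `h1` below.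
  -- For `d = 2` the bound on `B` controls `y = 2B`; for `d ≥ 3` the bound `T < 13/36` does.
  have hy6 : (12 * d - 13 - d * y - 13 * d * y ^ 2 : ℝ) ≥ 0 ∧ y ≤ 6 / 10 := by
    obtain rfl | hd3 := (show 2 ≤ d from hd2).eq_or_lt
    · have : y < 582 / 1000 := by rw [hy]; push_cast; linarith
      push_cast
      constructor <;> nlinarith
    · have hd3' : (3 : ℝ) ≤ d := by exact_mod_cast hd3
      have hT3 : T < 13 / 36 := by nlinarith
      have : y * (1 + y) < 13 / 36 * (1 + y + y ^ 2) := lt_of_le_of_lt hTq (by gcongr)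
      have hy1 : y < 566 / 1000 := by nlinarith
      refine ⟨?_, by linarith⟩
      have : (12 - y - 13 * y ^ 2) ≥ 7 := by nlinarith
      nlinarith
  obtain ⟨hpoly, hy6⟩ := hy6
  -- Uses only `t ≤ B = y / d` and `T ≥ y(1 + y) / (1 + y + y²)`.
  have hfin : t * (1 + (d - 1) * T) ≤ 12 / 13 * T := by
    have hcoef : 0 ≤ 12 * d - 13 * (d - 1) * y := by nlinarith
    have h1 : 13 * y ≤ T * (12 * d - 13 * (d - 1) * y) := by
      refine le_of_mul_le_mul_right (a := 1 + y + y ^ 2) ?_ (by positivity)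
      calc 13 * y * (1 + y + y ^ 2) ≤ y * (1 + y) * (12 * d - 13 * (d - 1) * y) := by
            nlinarith [mul_nonneg hypos.le hpoly]
        _ ≤ T * (1 + y + y ^ 2) * (12 * d - 13 * (d - 1) * y) := by gcongr
        _ = _ := by ring
    have h2 : d * (13 * (B * (1 + (d - 1) * T))) ≤ d * (12 * T) := by
      rw [hy] at h1; linarith
    have h3 := le_of_mul_le_mul_left h2 hd0
    have h4 : t * (1 + (d - 1) * T) ≤ B * (1 + (d - 1) * T) :=
      mul_le_mul_of_nonneg_right htB (by nlinarith)
    linarith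
  set z := d * (t * T) with hzdef
  have hzpos : 0 < z := by positivity
  have hzt : 12 / 13 * z ≤ tanh z := by
    exact mul_le_tanh hzpos.le (by linarith)
  calc d * t * (t * (1 + (d - 1) * T)) ≤ d * t * (12 / 13 * T) := by gcongr
    _ = 12 / 13 * z := by rw [hzdef]; ring
    _ ≤ tanh z := hzt
    _ < tanh b := tanh_strictMono hz

end PeerPrediction

/-! ### Correlation inequalities for the Ising model. -/

namespace PeerPrediction

open Real Finset

theorem Signal.val_one : Signal.val 1 = 1 := by simp [Signal.val]

theorem Signal.val_neg (s : Signal) : Signal.val (-s) = -s.val := by simp [Signal.val]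

theorem Signal.eq_one_or_neg_one (s : Signal) : s = 1 ∨ s = -1 := Int.units_eq_one_or s

theorem Signal.neg_one_le (s : Signal) : -1 ≤ s := by
  have h : ∀ s : ℤˣ, -1 ≤ s := by decide
  exact h s

theorem Signal.val_cases (s : Signal) : s.val = 1 ∨ s.val = -1 := by
  rcases s.eq_one_or_neg_one with rfl | rfl <;> simp [Signal.val]

theorem Signal.val_mul_self (s : Signal) : s.val * s.val = 1 := by
  rcases s.val_cases with h | h <;> rw [h] <;> norm_num

theorem Signal.abs_val (s : Signal) : |s.val| = 1 := by
  rcases s.val_cases with h | h <;> rw [h] <;> norm_num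

theorem Signal.val_mono : Monotone Signal.val := fun _ _ h =>
  Int.cast_le.2 (Units.val_le_val.2 h)

theorem Signal.mul_add_mul_le (a b a' b' : Signal) :
    a.val * b.val + a'.val * b'.val ≤
      (a ⊓ a').val * (b ⊓ b').val + (a ⊔ a').val * (b ⊔ b').val := by
  have h : ∀ a b a' b' : ℤˣ, (a * b + a' * b' : ℤ) ≤
      ((a ⊓ a' : ℤˣ) : ℤ) * ((b ⊓ b' : ℤˣ) : ℤ) +
        ((a ⊔ a' : ℤˣ) : ℤ) * ((b ⊔ b' : ℤˣ) : ℤ) := by decide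
  unfold Signal.val
  exact_mod_cast h a b a' b'

theorem edgeProd_mk {V : Type*} (s : V → Signal) (i j : V) :
    edgeProd s s(i, j) = (s i).val * (s j).val := rfl

section Ising

variable {V : Type*} [Fintype V] [DecidableEq V] (G : SimpleGraph V) [DecidableRel G.Adj]
  (β : Sym2 V → ℝ)

/-- The unnormalized Gibbs weight of a configuration. -/
noncomputable def isingWeight (s : V → Signal) : ℝ := exp (isingEnergy G β s)

/-- The partition function. -/
noncomputable def partitionFn : ℝ := ∑ s, isingWeight G β s

/-- The local field at `k`. -/
noncomputable def localField (k : V) (s : V → Signal) : ℝ :=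
  ∑ u ∈ G.neighborFinset k, β s(k, u) * (s u).val

/-- The two-point correlation `E[S_i S_j]`. -/
noncomputable def spinCorr (i j : V) : ℝ := ∑ s, isingMass G β s * ((s i).val * (s j).val)

variable {G β}

theorem isingWeight_pos (s : V → Signal) : 0 < isingWeight G β s := exp_pos _

theorem partitionFn_pos : 0 < partitionFn G β :=
  sum_pos (fun s _ => isingWeight_pos s) univ_nonempty

theorem isingMass_eq (s : V → Signal) :
    isingMass G β s = isingWeight G β s / partitionFn G β := rfl

theorem sum_isingMass_mul (f : (V → Signal) → ℝ) :
    ∑ s, isingMass G β s * f s = (∑ s, isingWeight G β s * f s) / partitionFn G β := by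
  rw [sum_div]
  exact sum_congr rfl fun s _ => by rw [isingMass_eq]; ring

theorem spinCorr_eq (i j : V) :
    spinCorr G β i j =
      (∑ s, isingWeight G β s * ((s i).val * (s j).val)) / partitionFn G β :=
  sum_isingMass_mul _

theorem sum_isingMass : ∑ s, isingMass G β s = 1 := by
  have := sum_isingMass_mul (G := G) (β := β) fun _ => 1
  simp only [mul_one] at this
  rw [this]
  exact div_self partitionFn_pos.ne'

theorem isingWeight_neg (s : V → Signal) : isingWeight G β (-s) = isingWeight G β s := by
  unfold isingWeight isingEnergy
  congr 1
  refine sum_congr rfl fun e _ => ?_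
  congr 1
  induction e with | _ i j
  simp [edgeProd_mk, Signal.val_neg]

theorem sum_isingWeight_mul_val (i : V) : ∑ s, isingWeight G β s * (s i).val = 0 := by
  have h : ∑ s, isingWeight G β s * (s i).val = -∑ s, isingWeight G β s * (s i).val := by
    rw [← sum_neg_distrib]
    refine Fintype.sum_equiv (Equiv.neg _) _ _ fun s => ?_
    simp [isingWeight_neg, Signal.val_neg]
  linarith

theorem sum_isingMass_mul_val (i : V) : ∑ s, isingMass G β s * (s i).val = 0 := by
  rw [sum_isingMass_mul, sum_isingWeight_mul_val, zero_div]

theorem spinCorr_self (i : V) : spinCorr G β i i = 1 := by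
  simp only [spinCorr, Signal.val_mul_self, mul_one, sum_isingMass]

/-! ### Positive association -/

theorem isingWeight_mul_le (hβ : ∀ e ∈ G.edgeSet, 0 ≤ β e) (a b : V → Signal) :
    isingWeight G β a * isingWeight G β b ≤
      isingWeight G β (a ⊓ b) * isingWeight G β (a ⊔ b) := by
  unfold isingWeight isingEnergy
  rw [← exp_add, ← exp_add, exp_le_exp, ← sum_add_distrib, ← sum_add_distrib]
  refine sum_le_sum fun e he => ?_
  rw [← mul_add, ← mul_add]
  refine mul_le_mul_of_nonneg_left ?_ (hβ e (SimpleGraph.mem_edgeFinset.1 he))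
  induction e with | _ i j
  simp only [edgeProd_mk, Pi.inf_apply, Pi.sup_apply]
  exact Signal.mul_add_mul_le _ _ _ _

/-- In the zero-field ferromagnetic model a spin is nonnegatively correlated with every
increasing observable. -/
theorem sum_isingWeight_val_mul_nonneg (hβ : ∀ e ∈ G.edgeSet, 0 ≤ β e) (i : V)
    {g : (V → Signal) → ℝ} (hg : Monotone g) :
    0 ≤ ∑ s, isingWeight G β s * ((s i).val * g s) := by
  set c := g fun _ => -1 with hc
  have hbot : ∀ s, c ≤ g s := fun s => hg fun v => Signal.neg_one_le (s v)
  -- `fkg` needs nonnegative functions, hence the shifts by `1` and by the minimum `c` of `g`. They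
  -- drop out because the spin has mean zero.
  have key := fkg (fun s : V → Signal => (s i).val + 1) (fun s => g s - c) (isingWeight G β)
    (fun s => (isingWeight_pos s).le)
    (fun s => by rcases (s i).val_cases with h | h <;> simp [h])
    (fun s => sub_nonneg.2 (hbot s))
    (fun a b h => add_le_add_left (Signal.val_mono (h i)) 1)
    (fun a b h => sub_le_sub_right (hg h) c) (isingWeight_mul_le hβ)
  have h0 := sum_isingWeight_mul_val (G := G) (β := β) i
  have e1 : ∑ s, isingWeight G β s * ((s i).val + 1) = partitionFn G β := by
    simp only [mul_add, sum_add_distrib, h0, mul_one, zero_add]; rfl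
  have e2 : ∑ s, isingWeight G β s * (((s i).val + 1) * (g s - c)) =
      ∑ s, isingWeight G β s * ((s i).val * g s) +
        ∑ s, isingWeight G β s * (g s - c) := by
    have : ∀ s, isingWeight G β s * (((s i).val + 1) * (g s - c)) =
        isingWeight G β s * ((s i).val * g s) - c * (isingWeight G β s * (s i).val) +
          isingWeight G β s * (g s - c) := fun s => by ring
    simp only [this, sum_add_distrib, sum_sub_distrib, ← mul_sum, h0]
    ring
  rw [e1, e2] at key
  have hZ : 0 < partitionFn G β := partitionFn_pos
  have key' := le_of_mul_le_mul_left key hZ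
  linarith

/-! ### The friend bound -/

/-- Delete the edge and restore it through `exp (b * x) = cosh b + x * sinh b` for `x = ±1`. The
correlation is `(C cosh b + Z' sinh b) / (Z' cosh b + C sinh b)`, where `Z'` and `C` belong to the
deleted model; it is at least `tanh b` because `C ≥ 0` by positive association. -/
theorem tanh_le_spinCorr (hβ : ∀ e ∈ G.edgeSet, 0 ≤ β e) {i j : V} (hij : G.Adj i j) :
    tanh (β s(i, j)) ≤ spinCorr G β i j := by
  set b := β s(i, j) with hb
  set β' := Function.update β s(i, j) 0 with hβ'
  have hβ'0 : ∀ e ∈ G.edgeSet, 0 ≤ β' e := fun e he => by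
    by_cases h : e = s(i, j)
    · simp [hβ', h]
    · simpa [hβ', h] using hβ e he
  have hw : ∀ s, isingWeight G β s =
      isingWeight G β' s * (cosh b + (s i).val * (s j).val * sinh b) := fun s => by
    have hmem : s(i, j) ∈ G.edgeFinset := SimpleGraph.mem_edgeFinset.2 hij
    have hE : isingEnergy G β s = isingEnergy G β' s + b * ((s i).val * (s j).val) := by
      unfold isingEnergy
      rw [← add_sum_erase _ _ hmem, ← add_sum_erase _ (fun e => β' e * edgeProd s e) hmem]
      have : ∑ e ∈ G.edgeFinset.erase s(i, j), β' e * edgeProd s e =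
          ∑ e ∈ G.edgeFinset.erase s(i, j), β e * edgeProd s e :=
        sum_congr rfl fun e he => by rw [hβ', Function.update_of_ne (ne_of_mem_erase he)]
      rw [this]
      simp [hβ', edgeProd_mk, hb]
      ring
    unfold isingWeight
    rw [hE, exp_add]
    congr 1
    rcases (s i).val_cases with h | h <;> rcases (s j).val_cases with h' | h' <;> rw [h, h'] <;>
      norm_num [cosh_add_sinh, ← sub_eq_add_neg, cosh_sub_sinh]
  set C := ∑ s, isingWeight G β' s * ((s i).val * (s j).val) with hC
  have hC0 : 0 ≤ C := sum_isingWeight_val_mul_nonneg hβ'0 i (g := fun s => (s j).val)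
    fun _ _ h => Signal.val_mono (h j)
  have hZ : partitionFn G β = partitionFn G β' * cosh b + C * sinh b := by
    unfold partitionFn
    rw [hC, sum_mul, sum_mul, ← sum_add_distrib]
    exact sum_congr rfl fun s _ => by rw [hw]; ring
  have hN : ∑ s, isingWeight G β s * ((s i).val * (s j).val) =
      C * cosh b + partitionFn G β' * sinh b := by
    unfold partitionFn
    rw [hC, sum_mul, sum_mul, ← sum_add_distrib]
    refine sum_congr rfl fun s _ => ?_
    have : (s i).val * (s j).val * ((s i).val * (s j).val) = 1 := by
      rw [mul_mul_mul_comm, Signal.val_mul_self, Signal.val_mul_self, one_mul]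
    rw [hw]
    linear_combination isingWeight G β' s * sinh b * this
  rw [spinCorr_eq, hN, tanh_eq_sinh_div_cosh, div_le_div_iff₀ (cosh_pos b) partitionFn_pos, hZ]
  nlinarith [cosh_sq b]

/-! ### Conditioning on all other spins -/

theorem localField_update (k : V) (s : V → Signal) (a : Signal) :
    localField G β k (Function.update s k a) = localField G β k s :=
  sum_congr rfl fun u hu => by
    rw [Function.update_of_ne ((G.mem_neighborFinset k u).1 hu).ne']

theorem isingEnergy_update_neg (k : V) (s : V → Signal) :
    isingEnergy G β (Function.update s k (-s k)) =
      isingEnergy G β s - 2 * ((s k).val * localField G β k s) := by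
  -- Only the edges through `k` feel the flip; they contribute the spin times the local field.
  have hsplit : ∀ s : V → Signal, isingEnergy G β s =
      (s k).val * localField G β k s +
        ∑ e ∈ G.edgeFinset with k ∉ e, β e * edgeProd s e := fun s => by
    unfold isingEnergy
    rw [← sum_filter_add_sum_filter_not G.edgeFinset (fun e => k ∈ e)]
    congr 1
    have himg : G.edgeFinset.filter (fun e => k ∈ e) =
        (G.neighborFinset k).image fun u => s(k, u) := by
      ext e
      induction e with | _ x y
      simp only [mem_filter, SimpleGraph.mem_edgeFinset, SimpleGraph.mem_edgeSet, Sym2.mem_iff,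
        mem_image, SimpleGraph.mem_neighborFinset]
      constructor
      · rintro ⟨h, rfl | rfl⟩
        · exact ⟨y, h, rfl⟩
        · exact ⟨x, h.symm, Sym2.eq_swap⟩
      · rintro ⟨u, hu, he⟩
        rcases Sym2.eq_iff.1 he with ⟨rfl, rfl⟩ | ⟨rfl, rfl⟩
        · exact ⟨hu, Or.inl rfl⟩
        · exact ⟨hu.symm, Or.inr rfl⟩
    rw [himg, sum_image fun u _ v _ h => Sym2.congr_right.1 h, localField, mul_sum]
    exact sum_congr rfl fun u _ => by rw [edgeProd_mk]; ring
  have hrest : ∑ e ∈ G.edgeFinset with k ∉ e, β e * edgeProd (Function.update s k (-s k)) e =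
      ∑ e ∈ G.edgeFinset with k ∉ e, β e * edgeProd s e :=
    sum_congr rfl fun e he => by
      have hk := (mem_filter.1 he).2
      induction e with | _ x y
      rw [Sym2.mem_iff, not_or] at hk
      rw [edgeProd_mk, edgeProd_mk, Function.update_of_ne (Ne.symm hk.1),
        Function.update_of_ne (Ne.symm hk.2)]
  rw [hsplit, hsplit s, localField_update, hrest, Function.update_self, Signal.val_neg]
  ring

/-- Under the sum, the spin at `k` may be replaced by its conditional mean given the others. -/
theorem sum_isingWeight_mul_val_eq_tanh {i k : V} (hik : i ≠ k) :
    ∑ s, isingWeight G β s * ((s i).val * (s k).val) =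
      ∑ s, isingWeight G β s * ((s i).val * tanh (localField G β k s)) := by
  rw [← sub_eq_zero, ← sum_sub_distrib]
  let F : (V → Signal) → ℝ := fun s => isingWeight G β s * ((s i).val * (s k).val) -
    isingWeight G β s * ((s i).val * tanh (localField G β k s))
  -- Pair each configuration with its flip at `k`: the two weights differ by the factor `exp (-2 *
  -- s_k * h)`, so the two terms of `F` cancel.
  let φ : Equiv.Perm (V → Signal) := Function.Involutive.toPerm
    (fun s => Function.update s k (-s k)) fun s => by simp
  have hφ : ∀ s, φ s = Function.update s k (-s k) := fun s => rfl
  have hF : ∀ s, F s + F (φ s) = 0 := fun s => by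
    simp only [F, hφ, isingWeight, isingEnergy_update_neg, localField_update,
      Function.update_self, Function.update_of_ne hik, Signal.val_neg]
    set h := localField G β k s
    rw [exp_sub]
    have e2 : exp (2 * h) = exp h * exp h := by rw [← exp_add]; ring_nf
    rcases (s k).val_cases with hs | hs <;> rw [hs, tanh_eq_exp]
    · rw [one_mul]; field_simp; ring
    · rw [show 2 * (-1 * h) = -(2 * h) by ring, exp_neg]; field_simp; ring
  have h1 : ∑ s, F s = ∑ s, F (φ s) := (Equiv.sum_comp φ F).symm
  have h2 : ∑ s, F s + ∑ s, F (φ s) = 0 := by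
    rw [← sum_add_distrib]; exact sum_eq_zero fun s _ => hF s
  change ∑ s, F s = 0
  linarith

/-- Raise the spins from `x` to `y` one at a time: each raised spin moves the argument by `2 * b u`,
so `tanh` gains at most `2 * tanh (b u)`. The offset `c` absorbs the spins already treated. -/
theorem tanh_sum_sub_tanh_sum_le {ι : Type*} (N : Finset ι) {b : ι → ℝ}
    (hb : ∀ u ∈ N, 0 ≤ b u) {x y : ι → Signal} (hxy : x ≤ y) (c : ℝ) :
    tanh (c + ∑ u ∈ N, b u * (y u).val) - tanh (c + ∑ u ∈ N, b u * (x u).val) ≤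
      ∑ u ∈ N, tanh (b u) * ((y u).val - (x u).val) := by
  classical
  induction N using Finset.induction_on generalizing c with
  | empty => simp
  | insert a N ha ih =>
    rw [sum_insert ha, sum_insert ha, sum_insert ha]
    have h1 := ih (fun u hu => hb u (mem_insert_of_mem hu)) (c + b a * (y a).val)
    have hba := hb a (mem_insert_self a N)
    have h2 : tanh (c + ∑ u ∈ N, b u * (x u).val + b a * (y a).val) -
        tanh (c + ∑ u ∈ N, b u * (x u).val + b a * (x a).val) ≤
          tanh (b a) * ((y a).val - (x a).val) := by
      have hle := Signal.val_mono (hxy a)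
      have h3 := tanh_add_sub_tanh_sub_le (c + ∑ u ∈ N, b u * (x u).val) hba
      rcases (x a).val_cases with hx | hx <;> rcases (y a).val_cases with hy | hy <;>
        rw [hx, hy] at hle ⊢
      · simp
      · norm_num at hle
      · rw [mul_one, mul_neg_one, ← sub_eq_add_neg]; linarith
      · simp
    have e1 : c + (b a * (y a).val + ∑ u ∈ N, b u * (y u).val) =
        c + b a * (y a).val + ∑ u ∈ N, b u * (y u).val := by ring
    have e2 : c + (b a * (x a).val + ∑ u ∈ N, b u * (x u).val) =
        c + ∑ u ∈ N, b u * (x u).val + b a * (x a).val := by ring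
    have e3 : c + b a * (y a).val + ∑ u ∈ N, b u * (x u).val =
        c + ∑ u ∈ N, b u * (x u).val + b a * (y a).val := by ring
    rw [e3] at h1
    rw [e1, e2]
    linarith

/-- A Simon-type inequality: correlations with `k` are controlled through its neighbours. -/
theorem spinCorr_le_sum_neighbor (hβ : ∀ e ∈ G.edgeSet, 0 ≤ β e) {i k : V} (hik : i ≠ k) :
    spinCorr G β i k ≤ ∑ u ∈ G.neighborFinset k, tanh (β s(k, u)) * spinCorr G β i u := by
  -- The linear majorant minus the conditional mean at `k` is increasing, hence nonnegatively
  -- correlated with the spin at `i`.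
  have hmono : Monotone fun s : V → Signal =>
      ∑ u ∈ G.neighborFinset k, tanh (β s(k, u)) * (s u).val - tanh (localField G β k s) :=
    fun x y hxy => by
      have := tanh_sum_sub_tanh_sum_le (G.neighborFinset k) (b := fun u => β s(k, u))
        (fun u hu => hβ _ ((G.mem_neighborFinset k u).1 hu)) hxy 0
      simp only [zero_add, mul_sub, sum_sub_distrib] at this
      simp only [localField]
      linarith
  have h := sum_isingWeight_val_mul_nonneg hβ i hmono
  have e : ∑ s, isingWeight G β s * ((s i).val *
      (∑ u ∈ G.neighborFinset k, tanh (β s(k, u)) * (s u).val - tanh (localField G β k s))) =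
      ∑ u ∈ G.neighborFinset k, tanh (β s(k, u)) *
        ∑ s, isingWeight G β s * ((s i).val * (s u).val) -
      ∑ s, isingWeight G β s * ((s i).val * tanh (localField G β k s)) := by
    simp only [mul_sub, sum_sub_distrib, mul_sum]
    rw [sum_comm]
    congr 1
    exact sum_congr rfl fun u _ => sum_congr rfl fun s _ => by ring
  rw [e, ← sum_isingWeight_mul_val_eq_tanh hik] at h
  simp only [spinCorr_eq, mul_div_assoc', ← sum_div]
  exact div_le_div_of_nonneg_right (by linarith) partitionFn_pos.le

theorem spinCorr_le_tanh {B : ℝ} {d : ℕ} (hβ : ∀ e ∈ G.edgeSet, 0 ≤ β e)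
    (hB : ∀ e ∈ G.edgeSet, β e ≤ B) (hB0 : 0 ≤ B) {i k : V} (hd : G.degree k ≤ d)
    (hik : i ≠ k) : spinCorr G β i k ≤ tanh (d * B) := by
  rw [spinCorr_eq, sum_isingWeight_mul_val_eq_tanh hik, div_le_iff₀ partitionFn_pos,
    partitionFn, mul_sum]
  refine sum_le_sum fun s _ => ?_
  rw [mul_comm]
  refine mul_le_mul_of_nonneg_right ?_ (isingWeight_pos s).le
  have hf : |localField G β k s| ≤ d * B := by
    calc |localField G β k s| ≤ ∑ u ∈ G.neighborFinset k, |β s(k, u) * (s u).val| :=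
          abs_sum_le_sum_abs _ _
      _ ≤ ∑ u ∈ G.neighborFinset k, B := sum_le_sum fun u hu => by
          have hu' : s(k, u) ∈ G.edgeSet := (G.mem_neighborFinset k u).1 hu
          rw [abs_mul, Signal.abs_val, mul_one, abs_of_nonneg (hβ _ hu')]
          exact hB _ hu'
      _ = G.degree k * B := by
          rw [sum_const, nsmul_eq_mul, SimpleGraph.card_neighborFinset_eq_degree]
      _ ≤ d * B := by gcongr
  obtain ⟨h1, h2⟩ := abs_le.1 hf
  rcases (s i).val_cases with h | h <;> rw [h]
  · rw [one_mul]; exact tanh_strictMono.monotone h2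
  · rw [neg_one_mul, ← tanh_neg]; exact tanh_strictMono.monotone (by linarith)

/-- The bound on the correlation of two distinct agents, refined by one Simon step. -/
theorem spinCorr_le_of_ne {B : ℝ} {d : ℕ} (hβ : ∀ e ∈ G.edgeSet, 0 ≤ β e)
    (hB : ∀ e ∈ G.edgeSet, β e ≤ B) (hB0 : 0 ≤ B) (hd : ∀ v, G.degree v ≤ d) {i u : V}
    (hiu : i ≠ u) : spinCorr G β i u ≤ tanh B * (1 + (d - 1) * tanh (d * B)) := by
  set t := tanh B with ht
  set T := tanh (d * B) with hT
  have ht0 : 0 ≤ t := tanh_nonneg hB0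
  have hT0 : 0 ≤ T := tanh_nonneg (by positivity)
  have hT1 : T ≤ 1 := (tanh_lt_one _).le
  calc spinCorr G β i u
      ≤ ∑ w ∈ G.neighborFinset u, tanh (β s(u, w)) * spinCorr G β i w :=
        spinCorr_le_sum_neighbor hβ hiu
    -- At most one neighbour of `u` is `i` itself, with correlation `1`; all others have correlation
    -- at most `T`.
    _ ≤ ∑ w ∈ G.neighborFinset u, t * (T + if w = i then 1 - T else 0) :=
        sum_le_sum fun w hw => by
          have hw' : s(u, w) ∈ G.edgeSet := (G.mem_neighborFinset u w).1 hw
          have h1 : tanh (β s(u, w)) ≤ t := tanh_strictMono.monotone (hB _ hw')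
          have h2 : spinCorr G β i w ≤ T + if w = i then 1 - T else 0 := by
            split_ifs with h
            · rw [h, spinCorr_self]; linarith
            · rw [add_zero]
              exact spinCorr_le_tanh hβ hB hB0 (hd w) (Ne.symm h)
          have h3 : 0 ≤ T + if w = i then 1 - T else 0 := by
            split_ifs <;> linarith
          exact (mul_le_mul_of_nonneg_left h2 (tanh_nonneg (hβ _ hw'))).trans
            (mul_le_mul_of_nonneg_right h1 h3)
    _ = t * (G.degree u * T + ∑ w ∈ G.neighborFinset u, if w = i then 1 - T else 0) := by
        rw [← mul_sum, sum_add_distrib, sum_const, nsmul_eq_mul,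
          SimpleGraph.card_neighborFinset_eq_degree]
    _ ≤ t * (d * T + (1 - T)) := by
        have h1 : (G.degree u : ℝ) ≤ d := by exact_mod_cast hd u
        have h2 : (∑ w ∈ G.neighborFinset u, if w = i then 1 - T else 0) ≤ 1 - T := by
          rw [sum_ite_eq']
          split_ifs <;> linarith
        gcongr
    _ = t * (1 + (d - 1) * T) := by ring

/-- A second Simon step, at `k`. Non-adjacency keeps `i` out of the neighbours of `k`, so the
refined bound applies to every term. -/
theorem spinCorr_le_of_not_adj {B : ℝ} {d : ℕ} (hβ : ∀ e ∈ G.edgeSet, 0 ≤ β e)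
    (hB : ∀ e ∈ G.edgeSet, β e ≤ B) (hB0 : 0 ≤ B) (hd1 : 1 ≤ d) (hd : ∀ v, G.degree v ≤ d)
    {i k : V} (hik : i ≠ k) (hadj : ¬ G.Adj i k) :
    spinCorr G β i k ≤ d * tanh B * (tanh B * (1 + (d - 1) * tanh (d * B))) := by
  have ht0 : 0 ≤ tanh B := tanh_nonneg hB0
  have hT0 : 0 ≤ tanh (d * B) := tanh_nonneg (by positivity)
  have hd1' : (1 : ℝ) ≤ d := by exact_mod_cast hd1
  set K := tanh B * (1 + (d - 1) * tanh (d * B)) with hK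
  have hK0 : 0 ≤ K := mul_nonneg ht0 (by nlinarith)
  calc spinCorr G β i k
      ≤ ∑ u ∈ G.neighborFinset k, tanh (β s(k, u)) * spinCorr G β i u :=
        spinCorr_le_sum_neighbor hβ hik
    _ ≤ ∑ u ∈ G.neighborFinset k, tanh B * K := sum_le_sum fun u hu => by
        have hku : G.Adj k u := (G.mem_neighborFinset k u).1 hu
        have hiu : i ≠ u := by rintro rfl; exact hadj hku.symm
        exact (mul_le_mul_of_nonneg_left (spinCorr_le_of_ne hβ hB hB0 hd hiu)
          (tanh_nonneg (hβ _ hku))).trans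
          (mul_le_mul_of_nonneg_right (tanh_strictMono.monotone (hB _ hku)) hK0)
    _ = G.degree k * (tanh B * K) := by
        rw [sum_const, nsmul_eq_mul, SimpleGraph.card_neighborFinset_eq_degree]
    _ ≤ d * (tanh B * K) := by
        gcongr
        exact_mod_cast hd k
    _ = d * tanh B * K := by ring

/-! ### Conditional probabilities -/

theorem prob_isingMass_eq (i : V) (a : Signal) :
    prob (isingMass G β) (fun s => s i = a) = 1 / 2 := by
  unfold prob
  rw [sum_filter]
  have : ∀ s : V → Signal, (if s i = a then isingMass G β s else 0) =
      1 / 2 * isingMass G β s + a.val / 2 * (isingMass G β s * (s i).val) := fun s => by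
    rcases (s i).eq_one_or_neg_one with h | h <;> rcases a.eq_one_or_neg_one with h' | h' <;>
      subst h' <;> rw [h] <;> simp [Signal.val_neg, Signal.val_one] <;> ring
  simp only [this, sum_add_distrib, ← mul_sum, sum_isingMass, sum_isingMass_mul_val]
  ring

/-- The indicator is `(1 + a s_i)(1 + a s_j) / 4`, and the single-spin terms have mean zero. -/
theorem prob_isingMass_and (i j : V) (a : Signal) :
    prob (isingMass G β) (fun s => s j = a ∧ s i = a) = (1 + spinCorr G β i j) / 4 := by
  unfold prob
  rw [sum_filter]
  have : ∀ s : V → Signal, (if s j = a ∧ s i = a then isingMass G β s else 0) =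
      1 / 4 * isingMass G β s + a.val / 4 * (isingMass G β s * (s i).val) +
        a.val / 4 * (isingMass G β s * (s j).val) +
        1 / 4 * (isingMass G β s * ((s i).val * (s j).val)) := fun s => by
    rcases (s i).eq_one_or_neg_one with h | h <;> rcases (s j).eq_one_or_neg_one with h1 | h1 <;>
      rcases a.eq_one_or_neg_one with h' | h' <;>
      subst h' <;> rw [h, h1] <;> simp [Signal.val_neg, Signal.val_one] <;> ring
  simp only [this, sum_add_distrib, ← mul_sum, sum_isingMass, sum_isingMass_mul_val]
  rw [spinCorr]
  ring

theorem uniformlyDominates_of_spinCorr_lt {i j k : V}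
    (h : spinCorr G β i k < spinCorr G β i j) :
    UniformlyDominates (isingMass G β) i j k := by
  unfold UniformlyDominates condProb
  simp only [prob_isingMass_and, prob_isingMass_eq]
  constructor <;> linarith

end Ising

end PeerPrediction

/-! ### Strategies, payments and equilibria. -/

namespace PeerPrediction

open Finset

theorem Signal.sum_univ (f : Signal → ℝ) : ∑ r, f r = f 1 + f (-1) := by
  have h : (Finset.univ : Finset ℤˣ) = {1, -1} := by decide
  change ∑ r ∈ (Finset.univ : Finset ℤˣ), f r = _
  rw [h, sum_pair (by decide)]

namespace Strategy

theorem toFun_add (σ : Strategy) (s : Signal) : σ.toFun s 1 + σ.toFun s (-1) = 1 := by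
  rw [← σ.sum_eq_one s, Signal.sum_univ]

/-- Half the sum of the conditional mean reports on the two signals. -/
noncomputable def bias (σ : Strategy) : ℝ := σ.toFun 1 1 + σ.toFun (-1) 1 - 1

/-- Half the difference of the conditional mean reports on the two signals. -/
noncomputable def gain (σ : Strategy) : ℝ := σ.toFun 1 1 - σ.toFun (-1) 1

theorem sum_toFun_mul_val (σ : Strategy) (s : Signal) :
    ∑ r, σ.toFun s r * r.val = σ.bias + σ.gain * s.val := by
  have h1 := σ.toFun_add 1
  have h2 := σ.toFun_add (-1)
  rw [Signal.sum_univ]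
  unfold bias gain
  rcases s.eq_one_or_neg_one with rfl | rfl <;>
    simp only [Signal.val_neg, Signal.val_one] <;> linarith

theorem abs_gain_le_one (σ : Strategy) : |σ.gain| ≤ 1 := by
  have h1 := σ.toFun_add 1
  have h2 := σ.toFun_add (-1)
  rw [abs_le]
  unfold gain
  constructor <;> linarith [σ.nonneg 1 1, σ.nonneg 1 (-1), σ.nonneg (-1) 1, σ.nonneg (-1) (-1)]

theorem ext_of_report_one {σ τ : Strategy} (h1 : σ.toFun 1 1 = τ.toFun 1 1)
    (h2 : σ.toFun (-1) 1 = τ.toFun (-1) 1) : σ = τ := by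
  have h : ∀ s, σ.toFun s 1 = τ.toFun s 1 := fun s => by
    rcases s.eq_one_or_neg_one with rfl | rfl <;> assumption
  ext s r
  have := h s
  rcases r.eq_one_or_neg_one with rfl | rfl
  · exact this
  · linarith [σ.toFun_add s, τ.toFun_add s]

theorem truthful_one : truthful.toFun 1 1 = 1 := by simp [truthful]

theorem truthful_neg_one : truthful.toFun (-1) 1 = 0 := by
  have h : (1 : ℤˣ) ≠ -1 := by decide
  exact if_neg (t := (1 : ℝ)) h

theorem gain_truthful : truthful.gain = 1 := by
  rw [gain, truthful_one, truthful_neg_one]; norm_num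

theorem perm_neg_one : (perm (Equiv.neg Signal)).toFun 1 1 = 0 := by
  have h : (1 : ℤˣ) ≠ -1 := by decide
  exact if_neg (t := (1 : ℝ)) h

theorem perm_neg_neg_one : (perm (Equiv.neg Signal)).toFun (-1) 1 = 1 := by
  have h : (1 : ℤˣ) = - -1 := by decide
  exact if_pos (e := (0 : ℝ)) h

/-- A difference of two probabilities equals `1` only if they are `1` and `0`. -/
theorem eq_truthful_of_gain_eq_one {σ : Strategy} (h : σ.gain = 1) : σ = truthful := by
  have h1 := σ.toFun_add 1
  unfold gain at h
  refine ext_of_report_one ?_ ?_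
  · rw [truthful_one]; linarith [σ.nonneg 1 (-1), σ.nonneg (-1) 1]
  · rw [truthful_neg_one]; linarith [σ.nonneg 1 (-1), σ.nonneg (-1) 1]

theorem eq_perm_neg_of_gain_eq_neg_one {σ : Strategy} (h : σ.gain = -1) :
    σ = perm (Equiv.neg Signal) := by
  have h1 := σ.toFun_add (-1)
  unfold gain at h
  refine ext_of_report_one ?_ ?_
  · rw [perm_neg_one]; linarith [σ.nonneg 1 1, σ.nonneg (-1) (-1)]
  · rw [perm_neg_neg_one]; linarith [σ.nonneg 1 1, σ.nonneg (-1) (-1)]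

theorem gain_perm (π : Equiv.Perm Signal) :
    (perm π).gain = 1 ∨ (perm π).gain = -1 := by
  have hne : π 1 ≠ π (-1) := π.injective.ne (by decide)
  have hu : (-1 : Signal) ≠ 1 := by decide
  unfold gain perm
  rcases (π 1).eq_one_or_neg_one with h | h <;> rcases (π (-1)).eq_one_or_neg_one with h' | h' <;>
    simp only [h, h', hu, hu.symm, ne_eq, not_true_eq_false] at hne ⊢ <;> norm_num

theorem exists_eq_perm_iff (σ : Strategy) :
    (∃ π : Equiv.Perm Signal, σ = perm π) ↔ σ.gain ^ 2 = 1 := by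
  constructor
  · rintro ⟨π, rfl⟩
    rcases gain_perm π with h | h <;> rw [h] <;> norm_num
  · intro h
    rcases mul_self_eq_one_iff.1 ((sq _).symm.trans h) with h | h
    · exact ⟨Equiv.refl _, eq_truthful_of_gain_eq_one h⟩
    · exact ⟨Equiv.neg _, eq_perm_neg_of_gain_eq_neg_one h⟩

end Strategy

section Payment

variable {V : Type*} [Fintype V] [DecidableEq V]

/-- Reports of distinct agents are independent given the signals. -/
theorem sum_reports_mul_val_mul_val (σ : V → Strategy) (s : V → Signal) {a b : V} (hab : a ≠ b) :
    ∑ r : V → Signal, (∏ v, (σ v).toFun (s v) (r v)) * ((r a).val * (r b).val) =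
      ((σ a).bias + (σ a).gain * (s a).val) * ((σ b).bias + (σ b).gain * (s b).val) := by
  -- The factors `if v = a` and `if v = b` turn the summand into a product over agents, so that sum
  -- and product can be exchanged.
  let f : V → Signal → ℝ := fun v x =>
    (σ v).toFun (s v) x * ((if v = a then x.val else 1) * (if v = b then x.val else 1))
  have h := Fintype.prod_sum f
  have e1 : ∀ r : V → Signal, ∏ v, f v (r v) =
      (∏ v, (σ v).toFun (s v) (r v)) * ((r a).val * (r b).val) := fun r => by
    simp only [f, prod_mul_distrib, prod_ite_eq', mem_univ, if_true]
  have e2 : ∀ v, ∑ x, f v x =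
      (if v = a then (σ v).bias + (σ v).gain * (s v).val else 1) *
        (if v = b then (σ v).bias + (σ v).gain * (s v).val else 1) := fun v => by
    by_cases ha : v = a
    · have hb : v ≠ b := ha ▸ hab
      simp only [f, if_pos ha, if_neg hb, mul_one, Strategy.sum_toFun_mul_val]
    · by_cases hb : v = b
      · simp only [f, if_pos hb, if_neg ha, one_mul, Strategy.sum_toFun_mul_val]
      · simp only [f, if_neg hb, if_neg ha, mul_one, Strategy.sum_eq_one]
  simp only [e1, e2, prod_mul_distrib, prod_ite_eq', mem_univ, if_true] at h
  exact h.symm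

variable {G : SimpleGraph V} [DecidableRel G.Adj] {β : Sym2 V → ℝ}

/-- The mixed bias-gain terms carry a single spin and vanish in zero field. -/
theorem expectedPayment_networkMechanism (c : PeerChoice G) (σ : V → Strategy) (i : V) :
    expectedPayment (isingMass G β) (networkMechanism c) σ i =
      (σ i).bias * ((σ (c.friend i)).bias - (σ (c.nonfriend i)).bias) +
      (σ i).gain * ((σ (c.friend i)).gain * spinCorr G β i (c.friend i) -
        (σ (c.nonfriend i)).gain * spinCorr G β i (c.nonfriend i)) := by
  have hij := (c.adj_friend i).ne
  have hik := (c.nonfriend_ne i).symm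
  unfold expectedPayment networkMechanism bonusPenalty
  simp only [mul_sub (∏ v, _), sum_sub_distrib, sum_reports_mul_val_mul_val σ _ hij,
    sum_reports_mul_val_mul_val σ _ hik]
  generalize c.friend i = j
  generalize c.nonfriend i = k
  have e : ∀ s : V → Signal, isingMass G β s *
      (((σ i).bias + (σ i).gain * (s i).val) * ((σ j).bias + (σ j).gain * (s j).val) -
        ((σ i).bias + (σ i).gain * (s i).val) * ((σ k).bias + (σ k).gain * (s k).val)) =
      (σ i).bias * ((σ j).bias - (σ k).bias) * isingMass G β s +
      (σ i).gain * ((σ j).bias - (σ k).bias) * (isingMass G β s * (s i).val) +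
      (σ i).bias * (σ j).gain * (isingMass G β s * (s j).val) -
      (σ i).bias * (σ k).gain * (isingMass G β s * (s k).val) +
      (σ i).gain * (σ j).gain * (isingMass G β s * ((s i).val * (s j).val)) -
      (σ i).gain * (σ k).gain * (isingMass G β s * ((s i).val * (s k).val)) :=
    fun s => by ring
  simp only [e, sum_add_distrib, sum_sub_distrib, ← mul_sum, sum_isingMass,
    sum_isingMass_mul_val]
  unfold spinCorr
  ring

/-- If friends are strictly more correlated than non-friends, the network mechanism is
symmetrically strongly truthful. -/
theorem symmetricallyStronglyTruthful_networkMechanism (c : PeerChoice G)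
    (hc : ∀ i, spinCorr G β i (c.nonfriend i) < spinCorr G β i (c.friend i)) :
    SymmetricallyStronglyTruthful (isingMass G β) (networkMechanism c) := by
  -- Friend and non-friend both differ from `i`, so both still play `ρ` after the deviation and
  -- their biases cancel.
  have hdev : ∀ (ρ : Strategy) (σ : V → Strategy), (∀ v, σ v = ρ) → ∀ (i : V) (τ : Strategy),
      expectedPayment (isingMass G β) (networkMechanism c) (Function.update σ i τ) i =
        τ.gain * ρ.gain * (spinCorr G β i (c.friend i) - spinCorr G β i (c.nonfriend i)) :=
    fun ρ σ hσ i τ => by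
      rw [expectedPayment_networkMechanism, Function.update_self,
        Function.update_of_ne (c.adj_friend i).ne', Function.update_of_ne (c.nonfriend_ne i),
        hσ, hσ]
      ring
  have hsymm : ∀ (ρ : Strategy) (σ : V → Strategy), (∀ v, σ v = ρ) → ∀ i : V,
      expectedPayment (isingMass G β) (networkMechanism c) σ i =
        ρ.gain * ρ.gain * (spinCorr G β i (c.friend i) - spinCorr G β i (c.nonfriend i)) :=
    fun ρ σ hσ i => by
      have := hdev ρ σ hσ i ρ
      rwa [← hσ i, Function.update_eq_self, hσ i] at this
  have htruth : ∀ v : V, (truthTelling : V → Strategy) v = Strategy.truthful := fun _ => rfl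
  refine ⟨fun i τ hτ => ?_, ?_, fun σ hσ _ i => ?_, fun σ hσ _ i => ?_⟩
  · rw [hdev _ _ htruth, hsymm _ _ htruth, Strategy.gain_truthful, mul_one, mul_one]
    refine mul_lt_mul_of_pos_right ?_ (sub_pos.2 (hc i))
    refine lt_of_le_of_ne (abs_le.1 τ.abs_gain_le_one).2 fun h => hτ ?_
    exact Strategy.eq_truthful_of_gain_eq_one h
  · rintro σ ⟨π, hπ⟩ i τ
    rw [hdev _ _ hπ, hsymm _ _ hπ]
    refine mul_le_mul_of_nonneg_right ?_ (sub_pos.2 (hc i)).le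
    obtain ⟨h1, h2⟩ := abs_le.1 τ.abs_gain_le_one
    rcases Strategy.gain_perm π with h | h <;> rw [h] <;> linarith
  · rw [hsymm (σ i) σ (fun v => hσ v i), hsymm _ _ htruth, Strategy.gain_truthful]
    refine mul_le_mul_of_nonneg_right ?_ (sub_pos.2 (hc i)).le
    obtain ⟨h1, h2⟩ := abs_le.1 (σ i).abs_gain_le_one
    nlinarith
  · rw [hsymm (σ i) σ (fun v => hσ v i), hsymm _ _ htruth, Strategy.gain_truthful,
      mul_left_inj' (sub_pos.2 (hc i)).ne', one_mul, ← sq, ← Strategy.exists_eq_perm_iff]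
    exact exists_congr fun π => ⟨fun h v => (hσ v i).trans h, fun h => h i⟩

end Payment

theorem spinCorr_not_adj_lt_spinCorr_adj {V : Type*} [Fintype V] [DecidableEq V]
    {G : SimpleGraph V} [DecidableRel G.Adj] {β : Sym2 V → ℝ}
    (hβ : ∀ e ∈ G.edgeSet, 0 ≤ β e) {βmin βmax : ℝ} (hmin : IsLeast (β '' G.edgeSet) βmin)
    (hmax : IsGreatest (β '' G.edgeSet) βmax)
    (hcond : 2 * βmin / (G.maxDegree : ℝ) >
      Real.log ((Real.exp (2 * ((G.maxDegree : ℝ) + 1) * βmax) + 1) /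
        (Real.exp (2 * βmax) + Real.exp (2 * (G.maxDegree : ℝ) * βmax))))
    {i j k : V} (hij : G.Adj i j) (hik : k ≠ i) (hnadj : ¬ G.Adj i k) :
    spinCorr G β i k < spinCorr G β i j := by
  have hd1 : 1 ≤ G.maxDegree :=
    Nat.succ_le_of_lt <| ((G.degree_pos_iff_exists_adj i).2 ⟨j, hij⟩).trans_le (G.degree_le_maxDegree i)
  have hB : ∀ e ∈ G.edgeSet, β e ≤ βmax := fun e he => hmax.2 ⟨e, he, rfl⟩
  have hb : ∀ e ∈ G.edgeSet, βmin ≤ β e := fun e he => hmin.2 ⟨e, he, rfl⟩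
  have hij' : s(i, j) ∈ G.edgeSet := hij
  have hB0 : 0 ≤ βmax := (hβ _ hij').trans (hB _ hij')
  have hlog : Real.tanh βmax * Real.tanh (G.maxDegree * βmax) <
      Real.tanh (βmin / G.maxDegree) := by
    refine tanh_mul_tanh_lt_of_log_lt ?_
    convert hcond using 1
    · ring_nf
    · ring
  calc spinCorr G β i k ≤ _ :=
        spinCorr_le_of_not_adj hβ hB hB0 hd1 G.degree_le_maxDegree hik.symm hnadj
    _ < Real.tanh βmin :=
        threshold_lt_tanh hd1 ((hb _ hij').trans (hB _ hij')) hB0 hlog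
    _ ≤ Real.tanh (β s(i, j)) := tanh_strictMono.monotone (hb _ hij')
    _ ≤ spinCorr G β i j := tanh_le_spinCorr hβ hij

end PeerPrediction

theorem theorem2 {V : Type*} [Fintype V] [DecidableEq V] (G : SimpleGraph V)
    [DecidableRel G.Adj] (β : Sym2 V → ℝ) (hβ : ∀ e ∈ G.edgeSet, 0 ≤ β e)
    (βmin βmax : ℝ) (hmin : IsLeast (β '' G.edgeSet) βmin)
    (hmax : IsGreatest (β '' G.edgeSet) βmax)
    (d : ℕ) (hd : d = G.maxDegree)
    (hcond : 2 * βmin / (d : ℝ) >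
      Real.log ((Real.exp (2 * ((d : ℝ) + 1) * βmax) + 1) /
        (Real.exp (2 * βmax) + Real.exp (2 * (d : ℝ) * βmax)))) :
    (∀ i j k : V, G.Adj i j → k ≠ i → ¬ G.Adj i k →
      PeerPrediction.UniformlyDominates (PeerPrediction.isingMass G β) i j k) ∧
    (∀ c : PeerPrediction.PeerChoice G,
      PeerPrediction.SymmetricallyStronglyTruthful (PeerPrediction.isingMass G β)
        (PeerPrediction.networkMechanism c)) := by

  subst hd
  exact ⟨fun i j k hij hik hnadj => PeerPrediction.uniformlyDominates_of_spinCorr_lt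
      (PeerPrediction.spinCorr_not_adj_lt_spinCorr_adj hβ hmin hmax hcond hij hik hnadj),
    fun c => PeerPrediction.symmetricallyStronglyTruthful_networkMechanism c fun i =>
      PeerPrediction.spinCorr_not_adj_lt_spinCorr_adj hβ hmin hmax hcond (c.adj_friend i)
        (c.nonfriend_ne i) (c.not_adj_nonfriend i)⟩
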